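/- Let $A$ be a unital commutative real algebra. Its character space $X(A)$, the set of all unital $\mathbb R$-algebra homomorphisms $A\to\mathbb R$, carries the weakest topology making all evaluations $\hat a:\alpha\mapsto\alpha(a)$ continuous, and the corresponding Borel $\sigma$-algebra; likewise for subalgebras. For a subset $M\subseteq A$ let $\langle M\rangle$ be the unital subalgebra generated by $M$. A Radon measure is a locally finite Borel measure that is inner regular with respect to compact sets. A representing Radon measure for a linear functional $\ell$ on an algebra $B$ is a Radon measure $\nu$ on $X(B)$ such that every $\hat b$ is $\nu$-integrable and $\ell(b)=\int\hat b\,d\nu$ for all $b\in B$. A Hilbertian seminorm $p$ on a real vector space is one of the form $p(v)=\sqrt{\langle v,v\rangle_p}$ with $\langle\cdot,\cdot\rangle_p$ a symmetric positive semidefinite bilinear form. For Hilbertian seminorms $p,q$ on the same space, $\mathrm{tr}(p/q):=\sup_E\sum_{e\in E}p(e)^2$, with $E$ ranging over the finite $q$-orthonormal sets, if $\ker q\subseteq\ker p$, and $\mathrm{tr}(p/q):=\infty$ otherwise. A linear functional $l$ is $p$-continuous if $|l|\le Cp$ for some $C>0$. Let $V\subseteq A$ be a linear subspace with $\langle V\rangle=A$,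 and let $L:A\to\mathbb R$ be linear with $L(1)=1$ and $L\ge 0$ on all finite sums of squares. Put $s_L(a)=\sqrt{L(a^2)}$; this is a Hilbertian seminorm with form $\langle a,b\rangle=L(ab)$. Let $(e_n)_{n\in I}$, $I$ countable, be a complete $s_L$-orthonormal system in $V$ (i.e. $s_L$-orthonormal, with $s_L$-dense linear span in $V$), let $\lambda_n>0$ $(n\in I)$ satisfy $\sum_n\lambda_n^2<\infty$, and set $$U:=\Big\{v\in V:\sum_{n}\lambda_n^{-2}L(ve_n)^2<\infty\Big\},\qquad q(v):=\Big(\sum_{n}\lambda_n^{-2}L(ve_n)^2\Big)^{1/2}\quad(v\in U).$$ Then $U$ is an $s_L$-dense linear subspace of $V$, $q$ is a Hilbertian seminorm on $U$, and $\mathrm{tr}(s_L|_U/q)<\infty$. Moreover, if there is a character $\alpha\in X(A)$ whose restriction to $U$ is $s_L$-continuous, and if for every finite dimensional subspace $W\subseteq U$ there is a representing Radon measure for $L|_{\langle W\rangle}$, then there is a representing Radon measure $\nu$ for $L|_{\langle U\rangle}$ that is supported on the characters whose restriction to $U$ is $q$-continuous, in the sense that $$\nu\big(X(\langle U\rangle)\setminus\{\alpha\in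 X(\langle U\rangle):\alpha|_U\text{ is }q\text{-continuous}\}\big)=0.$$ -/

import Mathlib

open MeasureTheory
open scoped ENNReal

/-- The character space `X(B)` of a real algebra: all unital `ℝ`-algebra homomorphisms `B → ℝ`. -/
def CharSpace (B : Type*) [CommRing B] [Algebra ℝ B] : Type _ := B →ₐ[ℝ] ℝ

namespace CharSpace

variable {B : Type*} [CommRing B] [Algebra ℝ B]

/-- The evaluation `α(b)` of a character `α` at `b`. -/
def eval (α : CharSpace B) (b : B) : ℝ := (show B →ₐ[ℝ] ℝ from α) b

/-- The weakest topology on `X(B)` making all evaluations `α ↦ α(b)` continuous. -/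
instance : TopologicalSpace (CharSpace B) :=
  TopologicalSpace.induced (fun α : CharSpace B => α.eval) inferInstance

/-- The Borel `σ`-algebra on `X(B)`. -/
instance : MeasurableSpace (CharSpace B) := borel _

instance : BorelSpace (CharSpace B) := ⟨rfl⟩

end CharSpace

/-- Radon measure: a Borel measure that is locally finite and inner regular with respect to
compact sets. -/
def IsRadonMeasure {X : Type*} [TopologicalSpace X] [MeasurableSpace X] (ν : Measure X) : Prop :=
  IsLocallyFiniteMeasure ν ∧ ν.InnerRegular

/-- `ν` is a representing Radon measure on `X(B)` for the linear functional `ℓ` on `B`: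
every `b̂` is integrable and `ℓ(b) = ∫ b̂ dν`. -/
def IsRepresentingRadonMeasure {B : Type*} [CommRing B] [Algebra ℝ B] (ℓ : B →ₗ[ℝ] ℝ)
    (ν : Measure (CharSpace B)) : Prop :=
  IsRadonMeasure ν ∧
    ∀ b : B, Integrable (fun α : CharSpace B => α.eval b) ν ∧ ℓ b = ∫ α, α.eval b ∂ν

section Hilbertian

variable {E : Type*} [AddCommGroup E] [Module ℝ E]

/-- `p` is a Hilbertian seminorm: it is induced by a symmetric positive semidefinite bilinear
form. (Such a function is automatically a seminorm.) -/
def IsHilbertianSeminorm (p : E → ℝ) : Prop :=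
  ∃ b : E →ₗ[ℝ] E →ₗ[ℝ] ℝ, (∀ v w, b v w = b w v) ∧ (∀ v, 0 ≤ b v v) ∧
    ∀ v, p v = Real.sqrt (b v v)

/-- The form `⟨v, w⟩_p` belonging to a Hilbertian seminorm `p`, by polarization. -/
noncomputable def hilbInner (p : E → ℝ) (v w : E) : ℝ :=
  (p (v + w) ^ 2 - p v ^ 2 - p w ^ 2) / 2

/-- `(e i)` is a complete `p`-orthonormal system in `E`: it is `p`-orthonormal and its linear
span is `p`-dense in `E`. -/
def IsCompleteOrthonormalSystem {ι : Type*} (p : E → ℝ) (e : ι → E) : Prop :=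
  (∀ i, p (e i) = 1) ∧ (∀ i j, i ≠ j → hilbInner p (e i) (e j) = 0) ∧
    ∀ v : E, ∀ ε > 0, ∃ u ∈ Submodule.span ℝ (Set.range e), p (v - u) < ε

/-- A finite `q`-orthonormal subset of `E`. -/
def IsFiniteOrthonormal (q : E → ℝ) (F : Finset E) : Prop :=
  (∀ f ∈ F, q f = 1) ∧ ∀ f ∈ F, ∀ g ∈ F, f ≠ g → hilbInner q f g = 0

open Classical in
/-- The trace `tr(p/q) ∈ [0, ∞]` of a Hilbertian seminorm `p` with respect to another one `q`. -/
noncomputable def hilbTrace (p q : E → ℝ) : ℝ≥0∞ :=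
  if ∀ v, q v = 0 → p v = 0 then
    ⨆ F : {F : Finset E // IsFiniteOrthonormal q F}, ∑ f ∈ F.1, ENNReal.ofReal (p f ^ 2)
  else ⊤

/-- `l` is continuous with respect to the seminorm `p`. -/
def IsContinuousFor (p l : E → ℝ) : Prop :=
  ∃ C > 0, ∀ v, |l v| ≤ C * p v

end Hilbertian

section Functional

variable {A : Type*} [CommRing A] [Algebra ℝ A]

/-- `L` is `∑A²`-positive: nonnegative on all finite sums of squares. -/
def IsSumSqPositive (L : A →ₗ[ℝ] ℝ) : Prop := ∀ a : A, IsSumSq a → 0 ≤ L a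

/-- The seminorm `s_L(a) = √(L(a²))`. -/
noncomputable def sL (L : A →ₗ[ℝ] ℝ) (a : A) : ℝ := Real.sqrt (L (a ^ 2))

/-- The form of `s_L` is `⟨a, b⟩ = L(ab)`. -/
theorem hilbInner_sL {L : A →ₗ[ℝ] ℝ} (hL : IsSumSqPositive L) (a b : A) :
    hilbInner (sL L) a b = L (a * b) := by
  have h : ∀ c : A, sL L c ^ 2 = L (c ^ 2) := fun c =>
    Real.sq_sqrt (hL _ (by rw [pow_two]; exact IsSumSq.mul_self c))
  have e : (a + b) ^ 2 = a ^ 2 + (a * b + a * b) + b ^ 2 := by ring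
  unfold hilbInner
  rw [h, h, h, e]
  simp only [map_add]
  ring

/-- The subspace `U = {v ∈ V : ∑ λ_n⁻² ⟨v, e_n⟩² < ∞}` of `V`, where `⟨v, e_n⟩ = L(v e_n)` is the
form of `s_L`. -/
def weightedSubspace {ι : Type*} (L : A →ₗ[ℝ] ℝ) (V : Submodule ℝ A) (e : ι → V) (lam : ι → ℝ) :
    Submodule ℝ A where
  carrier := {v | v ∈ V ∧ Summable fun n => (lam n)⁻¹ ^ 2 * L (v * (e n : A)) ^ 2}
  zero_mem' := ⟨V.zero_mem, by simp⟩
  add_mem' := by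
    rintro a b ⟨ha, ha'⟩ ⟨hb, hb'⟩
    refine ⟨V.add_mem ha hb, Summable.of_nonneg_of_le (fun n => by positivity) (fun n => ?_)
      ((ha'.add hb').mul_left 2)⟩
    rw [add_mul, map_add]
    nlinarith [mul_nonneg (sq_nonneg (lam n)⁻¹)
      (sq_nonneg (L (a * (e n : A)) - L (b * (e n : A))))]
  smul_mem' := by
    rintro c a ⟨ha, ha'⟩
    refine ⟨V.smul_mem c ha, (ha'.mul_left (c ^ 2)).congr fun n => ?_⟩
    rw [smul_mul_assoc, map_smul, smul_eq_mul]
    ring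

/-- The seminorm `q(v) = √(∑ λ_n⁻² ⟨v, e_n⟩²)`; it is meaningful for `v` in `U`, where the series
converges, and only used there. -/
noncomputable def weightedSeminorm {ι : Type*} (L : A →ₗ[ℝ] ℝ) (V : Submodule ℝ A) (e : ι → V)
    (lam : ι → ℝ) (v : A) : ℝ :=
  Real.sqrt (∑' n, (lam n)⁻¹ ^ 2 * L (v * (e n : A)) ^ 2)

/-- The restriction of `L` to a subalgebra `S`. -/
def restrictTo (L : A →ₗ[ℝ] ℝ) (S : Subalgebra ℝ A) : S →ₗ[ℝ] ℝ := L ∘ₗ S.val.toLinearMap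

/-- `J(U)`: the subalgebras `⟨W⟩` of `A` generated by finite dimensional subspaces `W` of `U`. -/
def finDimGenerated (U : Submodule ℝ A) : Set (Subalgebra ℝ A) :=
  {S | ∃ W : Submodule ℝ A, W ≤ U ∧ FiniteDimensional ℝ W ∧ S = Algebra.adjoin ℝ (W : Set A)}

/-- The restriction to `U` of a character of `⟨U⟩`. -/
def CharSpace.restrictGen (U : Submodule ℝ A) (α : CharSpace (Algebra.adjoin ℝ (U : Set A))) :
    U → ℝ :=
  fun u => α.eval ⟨(u : A), Algebra.subset_adjoin u.2⟩

end Functional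

/-! The form of `q` is pulled back from ℓ² along `J v = (λ_n⁻¹ L(v e_n))_n`. If `J f_i` are
orthonormal, Bessel's inequality at the n-th unit vector gives `∑_i L(f_i e_n)² ≤ λ_n²`. Summing
over `n` and using completeness of `(e_n)` yields `∑_i L(f_i²) ≤ T := ∑ λ_n²` (`sum_map_sq_le`), so
the trace is finite.

For the measure, take for each finite `G ⊆ U` a representing measure on the characters of `⟨span
G⟩`. By Markov's inequality the trace bound implies that `|α(u)| ≤ C q(u)` holds on all of `span G`
outside a set of measure at most `T / C²`, uniformly in `G` (`measureReal_not_bounded_le`). This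
tightness replaces compactness of the character space. Squash each real value into `[-1, 1]`, push
the measures to the compact cube `[-1, 1]^⟨U⟩`, and take a regular limit `μ` along an ultrafilter.

The character relations and the bound by `C q` are closed conditions on the cube, so by regularity
`μ` gives them mass at least `1 - T / C²`; letting `C → ∞` they hold almost surely for some `C`. A
point satisfying them has no infinite coordinate, because its values on the generators are bounded,
and hence is a character. Moments pass to the limit because `L(b²)` controls the truncation error
uniformly (`integrable_unsquash_of_trunc`). Pushing `μ` forward to the character space finishes the
proof (`exists_isRepresentingRadonMeasure_of_tight`). -/

/-! ### Limits of probability measures on compact spaces. -/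

section LimitMeasure

open Filter Topology

variable {K : Type*} [TopologicalSpace K] [T2Space K] [CompactSpace K] [MeasurableSpace K]
  [BorelSpace K]

/-- Along an ultrafilter, probability measures on a compact Hausdorff space converge to a regular
probability measure. -/
theorem exists_regular_tendsto_integral {I : Type*} (𝒰 : Ultrafilter I) (P : I → Measure K)
    [∀ i, IsProbabilityMeasure (P i)] :
    ∃ μ : Measure K, μ.Regular ∧ IsProbabilityMeasure μ ∧ ∀ f : K → ℝ, Continuous f →
      Tendsto (fun i => ∫ x, f x ∂(P i)) 𝒰 (𝓝 (∫ x, f x ∂μ)) := by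
  let Q : I → ProbabilityMeasure K := fun i => ⟨P i, inferInstance⟩
  obtain ⟨ρ, -, hρ⟩ := (isCompact_univ (X := ProbabilityMeasure K)).ultrafilter_le_nhds
    (𝒰.map Q) (by simp)
  -- `K` need not be metrizable, so `ρ` need not be regular; it is replaced by a regular measure
  -- with the same integrals of continuous functions.
  obtain ⟨μ, hreg, hfin, hμ⟩ := Measure.exists_regular_eq_of_compactSpace (ρ : Measure K)
  refine ⟨μ, hreg, ⟨?_⟩, fun f hf => ?_⟩
  · have h := hμ 1
    simp only [BoundedContinuousFunction.coe_one, Pi.one_apply, integral_const, smul_eq_mul,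
      mul_one, probReal_univ] at h
    exact (ENNReal.toReal_eq_one_iff _).1 h.symm
  · have := ProbabilityMeasure.tendsto_iff_forall_integral_tendsto.1
      (show Tendsto Q 𝒰 (𝓝 ρ) from hρ)
      (BoundedContinuousFunction.mkOfCompact ⟨f, hf⟩)
    rw [hμ] at this
    exact this

/-- Lower bounds for the measures of a decreasing family of closed sets pass to the intersection
and to the limit measure. -/
theorem le_measureReal_iInter_of_tendsto_integral {I : Type*} [Preorder I] [IsDirectedOrder I]
    [Nonempty I] {𝒰 : Ultrafilter I} (h𝒰 : (𝒰 : Filter I) ≤ atTop) {P : I → Measure K}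
    [∀ i, IsProbabilityMeasure (P i)] {μ : Measure K} [μ.Regular] [IsProbabilityMeasure μ]
    (hμ : ∀ f : K → ℝ, Continuous f → Tendsto (fun i => ∫ x, f x ∂(P i)) 𝒰 (𝓝 (∫ x, f x ∂μ)))
    {F : I → Set K} (hF : Antitone F) (hFc : ∀ i, IsClosed (F i)) {c : ℝ}
    (hc : ∀ i j, i ≤ j → c ≤ (P j).real (F i)) : c ≤ μ.real (⋂ i, F i) := by
  refine le_of_forall_pos_le_add fun ε hε => ?_
  -- The family may be uncountable, so continuity from above is not available. Outer regularity
  -- gives an open `W`, compactness puts a single `F i` inside it, and a Urysohn function fits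
  -- between the two indicators.
  obtain ⟨W, hFW, hW, hμW⟩ := (⋂ i, F i).exists_isOpen_le_add μ
    (ε := ENNReal.ofReal ε) (by simpa using hε)
  obtain ⟨i, hi⟩ := exists_subset_nhds_of_compactSpace (V := F) hF.directed_ge hFc
    (U := W) fun x hx => hW.mem_nhds (hFW hx)
  obtain ⟨f, hf0, hf1, hf⟩ := exists_continuous_zero_one_of_isClosed hW.isClosed_compl (hFc i)
    (Set.disjoint_compl_left_iff_subset.2 hi)
  have hint : ∀ ρ : Measure K, IsProbabilityMeasure ρ → Integrable f ρ := fun ρ _ =>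
    (BoundedContinuousFunction.mkOfCompact f).integrable ρ
  have h1 : c ≤ ∫ x, f x ∂μ := by
    refine ge_of_tendsto (hμ f f.continuous) (h𝒰 ?_)
    filter_upwards [eventually_ge_atTop i] with j hj
    refine (hc i j hj).trans ?_
    rw [← integral_indicator_one (hFc i).measurableSet]
    refine integral_mono ((integrable_indicator_iff (hFc i).measurableSet).2
      (integrable_const _).integrableOn) (hint _ inferInstance) fun x => ?_
    by_cases hx : x ∈ F i
    · simp [hx, hf1 hx]
    · simpa [hx] using (hf x).1
  have h2 : ∫ x, f x ∂μ ≤ μ.real W := by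
    rw [← integral_indicator_one hW.measurableSet]
    refine integral_mono (hint _ inferInstance) ((integrable_indicator_iff hW.measurableSet).2
      (integrable_const _).integrableOn) fun x => ?_
    by_cases hx : x ∈ W
    · simpa [hx] using (hf x).2
    · simp [hx, hf0 hx]
  have h3 : μ.real W ≤ μ.real (⋂ i, F i) + ε := by
    have := ENNReal.toReal_mono (by finiteness) hμW
    rwa [ENNReal.toReal_add (by finiteness) (by finiteness), ENNReal.toReal_ofReal hε.le] at this
  linarith

end LimitMeasure

/-! ### Squashing the line and bounded truncations. -/

section Squash

/-- The homeomorphism `x ↦ x / √(1 + x²)` of `ℝ` onto `(-1, 1)`. -/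
noncomputable def squash (x : ℝ) : ℝ := x / √(1 + x ^ 2)

/-- The inverse `t ↦ t / √(1 - t²)` of `squash`. -/
noncomputable def unsquash (t : ℝ) : ℝ := t / √(1 - t ^ 2)

theorem continuous_squash : Continuous squash := by
  unfold squash
  exact continuous_id.div (by fun_prop) fun x => (Real.sqrt_pos.2 (by positivity)).ne'

theorem one_sub_squash_sq (x : ℝ) : 1 - squash x ^ 2 = (1 + x ^ 2)⁻¹ := by
  have h : (0 : ℝ) < 1 + x ^ 2 := by positivity
  rw [squash, div_pow, Real.sq_sqrt h.le]
  field_simp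
  ring

theorem squash_mem_Icc (x : ℝ) : squash x ∈ Set.Icc (-1 : ℝ) 1 := by
  have h := one_sub_squash_sq x
  have : 0 < (1 + x ^ 2)⁻¹ := by positivity
  constructor <;> nlinarith

theorem sqrt_one_sub_squash_sq_pos (x : ℝ) : 0 < √(1 - squash x ^ 2) := by
  rw [one_sub_squash_sq]
  positivity

theorem unsquash_squash (x : ℝ) : unsquash (squash x) = x := by
  have h : (0 : ℝ) < 1 + x ^ 2 := by positivity
  have h' : √(1 + x ^ 2) ≠ 0 := (Real.sqrt_pos.2 h).ne'
  rw [unsquash, one_sub_squash_sq, Real.sqrt_inv, squash]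
  field_simp

theorem eq_unsquash_mul {t : ℝ} (ht : 0 < √(1 - t ^ 2)) : t = unsquash t * √(1 - t ^ 2) := by
  rw [unsquash]
  field_simp

theorem continuousOn_unsquash : ContinuousOn unsquash {t | 0 < √(1 - t ^ 2)} := by
  unfold unsquash
  exact continuousOn_id.div (by fun_prop) fun t ht => ne_of_gt ht

theorem measurable_unsquash : Measurable unsquash := by
  unfold unsquash
  fun_prop

/-- In the coordinate `x = unsquash t` this is the truncation `x / (1 + δ² x²)`. -/
noncomputable def truncFst (δ t : ℝ) : ℝ := t * √(1 - t ^ 2) / (1 - t ^ 2 + δ ^ 2 * t ^ 2)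

/-- In the coordinate `x = unsquash t` this is the truncation `x² / (1 + δ² x²)`. -/
noncomputable def truncSnd (δ t : ℝ) : ℝ := t ^ 2 / (1 - t ^ 2 + δ ^ 2 * t ^ 2)

/-- At `t = ±1`, the points at infinity, the denominator is `δ²`. Thus the truncations are
continuous on the whole closed interval and can be tested against weak limits. -/
theorem trunc_denom_pos {δ t : ℝ} (hδ : 0 < δ) (ht : t ∈ Set.Icc (-1 : ℝ) 1) :
    0 < 1 - t ^ 2 + δ ^ 2 * t ^ 2 := by
  have h1 : 0 ≤ 1 - t ^ 2 := by nlinarith [ht.1, ht.2]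
  rcases eq_or_ne t 0 with rfl | h
  · norm_num
  · positivity

theorem continuousOn_truncFst {δ : ℝ} (hδ : 0 < δ) :
    ContinuousOn (truncFst δ) (Set.Icc (-1 : ℝ) 1) := by
  unfold truncFst
  exact ContinuousOn.div (by fun_prop) (by fun_prop) fun t ht => (trunc_denom_pos hδ ht).ne'

theorem continuousOn_truncSnd {δ : ℝ} (hδ : 0 < δ) :
    ContinuousOn (truncSnd δ) (Set.Icc (-1 : ℝ) 1) := by
  unfold truncSnd
  exact ContinuousOn.div (by fun_prop) (by fun_prop) fun t ht => (trunc_denom_pos hδ ht).ne'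

theorem truncFst_eq (δ : ℝ) {t : ℝ} (ht : 0 < √(1 - t ^ 2)) :
    truncFst δ t = unsquash t / (1 + δ ^ 2 * unsquash t ^ 2) := by
  have hs : √(1 - t ^ 2) ^ 2 = 1 - t ^ 2 := Real.sq_sqrt (Real.sqrt_pos.1 ht).le
  rw [truncFst, unsquash]
  generalize √(1 - t ^ 2) = s at ht hs ⊢
  rw [← hs]
  field_simp

theorem truncSnd_eq (δ : ℝ) {t : ℝ} (ht : 0 < √(1 - t ^ 2)) :
    truncSnd δ t = unsquash t ^ 2 / (1 + δ ^ 2 * unsquash t ^ 2) := by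
  have hs : √(1 - t ^ 2) ^ 2 = 1 - t ^ 2 := Real.sq_sqrt (Real.sqrt_pos.1 ht).le
  rw [truncSnd, unsquash]
  generalize √(1 - t ^ 2) = s at ht hs ⊢
  rw [← hs]
  field_simp

theorem truncSnd_le (δ : ℝ) {t : ℝ} (ht : 0 < √(1 - t ^ 2)) :
    truncSnd δ t ≤ unsquash t ^ 2 := by
  rw [truncSnd_eq δ ht]
  exact div_le_self (by positivity) (by nlinarith [mul_nonneg (sq_nonneg δ) (sq_nonneg (unsquash t))])

/-- The error is `δx²` times `δx / (1 + δ²x²)` up to sign, and the last factor is at most 1 in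
absolute value. A second moment therefore controls the truncation of the mean. -/
theorem abs_truncFst_sub_le {δ : ℝ} (hδ : 0 < δ) {t : ℝ} (ht : 0 < √(1 - t ^ 2)) :
    |truncFst δ t - unsquash t| ≤ δ * unsquash t ^ 2 := by
  rw [truncFst_eq δ ht]
  generalize unsquash t = x
  have h : 0 < 1 + δ ^ 2 * x ^ 2 := by positivity
  have e : x / (1 + δ ^ 2 * x ^ 2) - x = -(δ * x ^ 2 * (δ * x / (1 + δ ^ 2 * x ^ 2))) := by
    field_simp
    ring
  rw [e, abs_neg, abs_mul, abs_of_nonneg (by positivity : 0 ≤ δ * x ^ 2)]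
  refine mul_le_of_le_one_right (by positivity) ?_
  rw [abs_div, abs_of_pos h, div_le_one h, abs_le]
  constructor <;> nlinarith [sq_nonneg (δ * x - 1), sq_nonneg (δ * x + 1)]

end Squash

/-! ### Recovering moments from truncations. -/

section Moments

open Filter Topology

/-- The truncated first and second moments determine integrability and the mean. -/
theorem integrable_unsquash_of_trunc {K : Type*} [TopologicalSpace K] [MeasurableSpace K]
    [BorelSpace K] (μ : Measure K) [IsProbabilityMeasure μ] {t : K → ℝ} (ht : Continuous t)
    (hmem : ∀ x, t x ∈ Set.Icc (-1 : ℝ) 1) (hfin : ∀ᵐ x ∂μ, 0 < √(1 - t x ^ 2)) {m M : ℝ}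
    (hfst : ∀ δ > 0, |∫ x, truncFst δ (t x) ∂μ - m| ≤ δ * M)
    (hsnd : ∀ δ > 0, ∫ x, truncSnd δ (t x) ∂μ ≤ M) :
    Integrable (fun x => unsquash (t x)) μ ∧ m = ∫ x, unsquash (t x) ∂μ := by
  have hmeas : Measurable fun x => unsquash (t x) := measurable_unsquash.comp ht.measurable
  have hbdd : ∀ {g : ℝ → ℝ}, ContinuousOn g (Set.Icc (-1 : ℝ) 1) →
      Integrable (fun x => g (t x)) μ := fun {g} hg => by
    obtain ⟨C, hC⟩ := isCompact_Icc.exists_bound_of_continuousOn hg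
    exact Integrable.of_bound (hg.comp_continuous ht hmem).measurable.aestronglyMeasurable C
      (Eventually.of_forall fun x => hC _ (hmem x))
  -- Fatou's lemma along `δ = 1 / (n + 1)`.
  have hsq : Integrable (fun x => unsquash (t x) ^ 2) μ := by
    have hd : ∀ n : ℕ, (0 : ℝ) < 1 / ((n : ℝ) + 1) := fun n => Nat.one_div_pos_of_nat
    have hle : ∫⁻ x, ENNReal.ofReal (unsquash (t x) ^ 2) ∂μ ≤ ENNReal.ofReal M := by
      calc ∫⁻ x, ENNReal.ofReal (unsquash (t x) ^ 2) ∂μ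
          = ∫⁻ x, liminf (fun n : ℕ => ENNReal.ofReal (truncSnd (1 / ((n : ℝ) + 1)) (t x))) atTop
              ∂μ := by
            refine lintegral_congr_ae (hfin.mono fun x hx => ?_)
            refine (Tendsto.liminf_eq (ENNReal.tendsto_ofReal ?_)).symm
            simp only [truncSnd_eq _ hx]
            have h : Tendsto (fun n : ℕ => unsquash (t x) ^ 2 /
                (1 + (1 / ((n : ℝ) + 1)) ^ 2 * unsquash (t x) ^ 2)) atTop
                (𝓝 (unsquash (t x) ^ 2 / (1 + 0 ^ 2 * unsquash (t x) ^ 2))) :=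
              tendsto_const_nhds.div (tendsto_const_nhds.add
                ((tendsto_one_div_add_atTop_nhds_zero_nat.pow 2).mul_const _)) (by simp)
            simpa using h
        _ ≤ liminf (fun n : ℕ => ∫⁻ x, ENNReal.ofReal (truncSnd (1 / ((n : ℝ) + 1)) (t x)) ∂μ)
              atTop := lintegral_liminf_le fun n =>
            ((continuousOn_truncSnd (hd n)).comp_continuous ht hmem).measurable.ennreal_ofReal
        _ ≤ ENNReal.ofReal M := by
            refine (liminf_le_liminf (Eventually.of_forall fun n => ?_)).trans
              (liminf_const _).le
            rw [← ofReal_integral_eq_lintegral_ofReal (hbdd (continuousOn_truncSnd (hd n)))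
              (Eventually.of_forall fun x =>
                div_nonneg (sq_nonneg _) (trunc_denom_pos (hd n) (hmem x)).le)]
            exact ENNReal.ofReal_le_ofReal (hsnd _ (hd n))
    refine ⟨(hmeas.pow_const 2).aestronglyMeasurable, ?_⟩
    rw [hasFiniteIntegral_iff_ofReal (Eventually.of_forall fun x => sq_nonneg _)]
    exact hle.trans_lt ENNReal.ofReal_lt_top
  have hint : Integrable (fun x => unsquash (t x)) μ := by
    refine ((integrable_const (1 : ℝ)).add hsq).mono' hmeas.aestronglyMeasurable
      (Eventually.of_forall fun x => ?_)
    rw [Real.norm_eq_abs, Pi.add_apply, abs_le]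
    constructor <;> nlinarith [sq_nonneg (unsquash (t x) - 1), sq_nonneg (unsquash (t x) + 1)]
  refine ⟨hint, ?_⟩
  set Q := ∫ x, unsquash (t x) ^ 2 ∂μ
  -- Both the true mean and `m` are close to the truncated mean, with errors `δQ` and `δM`.
  have key : ∀ δ > 0, |∫ x, unsquash (t x) ∂μ - m| ≤ δ * (M + Q) := fun δ hδ => by
    have h1 : |∫ x, truncFst δ (t x) ∂μ - ∫ x, unsquash (t x) ∂μ| ≤ δ * Q := by
      rw [← integral_sub (hbdd (continuousOn_truncFst hδ)) hint, ← integral_const_mul]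
      refine (abs_integral_le_integral_abs).trans (integral_mono_ae
        ((hbdd (continuousOn_truncFst hδ)).sub hint).abs (hsq.const_mul δ) ?_)
      exact hfin.mono fun x hx => abs_truncFst_sub_le hδ hx
    have h2 := hfst δ hδ
    rw [abs_le] at h1 h2 ⊢
    constructor <;> linarith
  have hlim : Tendsto (fun δ : ℝ => δ * (M + Q)) (𝓝[>] 0) (𝓝 (0 * (M + Q))) :=
    ((continuous_id.mul continuous_const).tendsto 0).mono_left nhdsWithin_le_nhds
  rw [zero_mul] at hlim
  have h0 : |∫ x, unsquash (t x) ∂μ - m| ≤ 0 :=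
    ge_of_tendsto hlim (eventually_nhdsWithin_of_forall fun δ hδ => key δ hδ)
  linarith [abs_eq_zero.1 (le_antisymm h0 (abs_nonneg _))]

end Moments

/-! ### Characters as points of a compact cube. -/

section Cube

/-- The compact cube `[-1, 1]^B` with its Borel `σ`-algebra. -/
def Cube (B : Type*) : Type _ := B → Set.Icc (-1 : ℝ) 1

namespace Cube

instance (B : Type*) : TopologicalSpace (Cube B) :=
  inferInstanceAs (TopologicalSpace (B → Set.Icc (-1 : ℝ) 1))
instance (B : Type*) : T2Space (Cube B) := inferInstanceAs (T2Space (B → Set.Icc (-1 : ℝ) 1))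
instance (B : Type*) : CompactSpace (Cube B) :=
  inferInstanceAs (CompactSpace (B → Set.Icc (-1 : ℝ) 1))
instance (B : Type*) : MeasurableSpace (Cube B) := borel _
instance (B : Type*) : BorelSpace (Cube B) := ⟨rfl⟩

/-- The coordinate of a point of the cube at `b`. -/
def coord {B : Type*} (b : B) (t : Cube B) : ℝ := ((show B → Set.Icc (-1 : ℝ) 1 from t) b : ℝ)

theorem coord_mem {B : Type*} (b : B) (t : Cube B) : coord b t ∈ Set.Icc (-1 : ℝ) 1 :=
  ((show B → Set.Icc (-1 : ℝ) 1 from t) b).2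

@[fun_prop]
theorem continuous_coord {B : Type*} (b : B) : Continuous (coord b : Cube B → ℝ) :=
  continuous_subtype_val.comp (continuous_apply b)

/-- The squashed version of a function `B → ℝ`. -/
noncomputable def ofFun {B : Type*} (x : B → ℝ) : Cube B := fun b => ⟨squash (x b), squash_mem_Icc _⟩

@[simp]
theorem coord_ofFun {B : Type*} (x : B → ℝ) (b : B) : coord b (ofFun x) = squash (x b) := rfl

theorem continuous_ofFun {B Ω : Type*} [TopologicalSpace Ω] {x : Ω → B → ℝ}
    (hx : ∀ b, Continuous fun ω => x ω b) : Continuous fun ω => ofFun (x ω) :=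
  continuous_pi fun b => (continuous_squash.comp (hx b)).subtype_mk _

/-- `√(1 - t_b²)`, which is positive exactly when the coordinate at `b` is finite. -/
noncomputable def cocoord {B : Type*} (b : B) (t : Cube B) : ℝ := √(1 - coord b t ^ 2)

@[fun_prop]
theorem continuous_cocoord {B : Type*} (b : B) : Continuous (cocoord b : Cube B → ℝ) := by
  unfold cocoord
  fun_prop

theorem cocoord_nonneg {B : Type*} (b : B) (t : Cube B) : 0 ≤ cocoord b t := Real.sqrt_nonneg _

theorem cocoord_sq {B : Type*} (b : B) (t : Cube B) : cocoord b t ^ 2 = 1 - coord b t ^ 2 := by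
  have := coord_mem b t
  exact Real.sq_sqrt (by nlinarith [this.1, this.2])

/-- The value in `ℝ` of the coordinate at `b`. -/
noncomputable def val {B : Type*} (b : B) (t : Cube B) : ℝ := unsquash (coord b t)

theorem coord_eq {B : Type*} {b : B} {t : Cube B} (h : 0 < cocoord b t) :
    coord b t = val b t * cocoord b t := eq_unsquash_mul h

@[simp]
theorem val_ofFun {B : Type*} (x : B → ℝ) (b : B) : val b (ofFun x) = x b := unsquash_squash _

theorem cocoord_ofFun_pos {B : Type*} (x : B → ℝ) (b : B) : 0 < cocoord b (ofFun x) :=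
  sqrt_one_sub_squash_sq_pos _

theorem cocoord_pos_of_ne {B : Type*} {b : B} {t : Cube B} (h : cocoord b t ≠ 0) : 0 < cocoord b t :=
  lt_of_le_of_ne (cocoord_nonneg b t) h.symm

theorem coord_ne_zero {B : Type*} {b : B} {t : Cube B} (h : cocoord b t = 0) : coord b t ≠ 0 := fun h' => by
  have := cocoord_sq b t
  rw [h, h'] at this
  norm_num at this

variable {B : Type*} [CommRing B] [Algebra ℝ B]

/-- The points of the cube which satisfy the squashed relations of a character, as far as they
involve the set `S`, and are bounded by `w` on `D`. -/
def characterLike (S D : Set B) (w : B → ℝ) : Set (Cube B) :=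
  {t | (∀ r : ℝ, coord (algebraMap ℝ B r) t = squash r) ∧
    -- The relations for `x_b = coord b t / cocoord b t` are cleared of denominators, so that they
    -- make sense at infinite coordinates and define closed sets.
    (∀ b ∈ S, ∀ c ∈ S, (coord b t * cocoord c t + coord c t * cocoord b t) * cocoord (b + c) t =
      coord (b + c) t * (cocoord b t * cocoord c t)) ∧
    (∀ b ∈ S, ∀ c ∈ S, coord b t * coord c t * cocoord (b * c) t =
      coord (b * c) t * (cocoord b t * cocoord c t)) ∧
    ∀ u ∈ D, |coord u t| ≤ w u * cocoord u t}

theorem isClosed_characterLike (S D : Set B) (w : B → ℝ) : IsClosed (characterLike S D w) := by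
  simp only [characterLike, Set.ofPred_and, Set.ofPred_forall]
  refine .inter (isClosed_iInter fun r => isClosed_eq (by fun_prop) (by fun_prop)) (.inter ?_
    (.inter ?_ (isClosed_iInter fun u => isClosed_iInter fun _ =>
      isClosed_le (by fun_prop) (by fun_prop)))) <;>
  exact isClosed_iInter fun b => isClosed_iInter fun _ => isClosed_iInter fun c =>
    isClosed_iInter fun _ => isClosed_eq (by fun_prop) (by fun_prop)

theorem characterLike_anti {S S' D D' : Set B} (hS : S ⊆ S') (hD : D ⊆ D') (w : B → ℝ) :
    characterLike S' D' w ⊆ characterLike S D w := fun _ ht =>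
  ⟨ht.1, fun b hb c hc => ht.2.1 b (hS hb) c (hS hc),
    fun b hb c hc => ht.2.2.1 b (hS hb) c (hS hc), fun u hu => ht.2.2.2 u (hD hu)⟩

theorem ofFun_mem_characterLike {S D : Set B} {w x : B → ℝ}
    (halg : ∀ r, x (algebraMap ℝ B r) = r) (hadd : ∀ b ∈ S, ∀ c ∈ S, x (b + c) = x b + x c)
    (hmul : ∀ b ∈ S, ∀ c ∈ S, x (b * c) = x b * x c) (hD : ∀ u ∈ D, |x u| ≤ w u) :
    ofFun x ∈ characterLike S D w := by
  have h : ∀ b, coord b (ofFun x) = x b * cocoord b (ofFun x) := fun b => by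
    rw [coord_eq (cocoord_ofFun_pos x b), val_ofFun]
  refine ⟨fun r => by rw [coord_ofFun, halg], fun b hb c hc => ?_, fun b hb c hc => ?_,
    fun u hu => ?_⟩
  · rw [h b, h c, h (b + c), hadd b hb c hc]
    ring
  · rw [h b, h c, h (b * c), hmul b hb c hc]
    ring
  · rw [h u, abs_mul, abs_of_nonneg (cocoord_nonneg _ _)]
    exact mul_le_mul_of_nonneg_right (hD u hu) (cocoord_nonneg _ _)

section Character

variable {D : Set B} {w : B → ℝ} {t : Cube B}

/-- If `cocoord` vanished, the bound (on generators) or the cleared relation (for sums and products)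
would make `coord` vanish too, but their squares add up to 1. -/
theorem cocoord_pos (hD : Algebra.adjoin ℝ D = ⊤) (ht : t ∈ characterLike Set.univ D w) (b : B) :
    0 < cocoord b t := by
  have hb : b ∈ Algebra.adjoin ℝ D := hD ▸ Algebra.mem_top
  induction hb using Algebra.adjoin_induction with
  | mem u hu =>
    refine cocoord_pos_of_ne fun h => coord_ne_zero h ?_
    have := ht.2.2.2 u hu
    rw [h, mul_zero] at this
    exact abs_eq_zero.1 (le_antisymm this (abs_nonneg _))
  | algebraMap r =>
    rw [cocoord, ht.1 r]
    exact sqrt_one_sub_squash_sq_pos r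
  | add b c _ _ hb hc =>
    refine cocoord_pos_of_ne fun h => coord_ne_zero h ?_
    have := ht.2.1 b trivial c trivial
    rw [h, mul_zero] at this
    exact (mul_eq_zero.1 this.symm).resolve_right (mul_pos hb hc).ne'
  | mul b c _ _ hb hc =>
    refine cocoord_pos_of_ne fun h => coord_ne_zero h ?_
    have := ht.2.2.1 b trivial c trivial
    rw [h, mul_zero] at this
    exact (mul_eq_zero.1 this.symm).resolve_right (mul_pos hb hc).ne'

/-- The character defined by a character-like point of the cube. -/
noncomputable def toCharSpace (hD : Algebra.adjoin ℝ D = ⊤)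
    (ht : t ∈ characterLike Set.univ D w) : CharSpace B :=
  have halg : ∀ r, val (algebraMap ℝ B r) t = r := fun r => by
    rw [val, ht.1 r, unsquash_squash]
  have hpos := cocoord_pos hD ht
  have hadd : ∀ b c, val (b + c) t = val b t + val c t := fun b c => by
    have h := ht.2.1 b trivial c trivial
    rw [coord_eq (hpos b), coord_eq (hpos c), coord_eq (hpos (b + c))] at h
    have hp := mul_pos (mul_pos (hpos b) (hpos c)) (hpos (b + c))
    refine (mul_right_cancel₀ hp.ne' ?_).symm
    linarith
  have hmul : ∀ b c, val (b * c) t = val b t * val c t := fun b c => by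
    have h := ht.2.2.1 b trivial c trivial
    rw [coord_eq (hpos b), coord_eq (hpos c), coord_eq (hpos (b * c))] at h
    have hp := mul_pos (mul_pos (hpos b) (hpos c)) (hpos (b * c))
    refine (mul_right_cancel₀ hp.ne' ?_).symm
    linarith
  show B →ₐ[ℝ] ℝ from
  { toFun := fun b => val b t
    map_one' := by simpa using halg 1
    map_mul' := hmul
    map_zero' := by simpa using halg 0
    map_add' := hadd
    commutes' := halg }

theorem abs_val_le (hD : Algebra.adjoin ℝ D = ⊤) (ht : t ∈ characterLike Set.univ D w) {u : B}
    (hu : u ∈ D) : |val u t| ≤ w u := by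
  have hp := cocoord_pos hD ht u
  have h := ht.2.2.2 u hu
  rw [coord_eq hp, abs_mul, abs_of_pos hp] at h
  exact le_of_mul_le_mul_right h hp

end Character

end Cube

end Cube

/-! ### From tightness to a representing measure. -/

section Existence

open Filter Topology

theorem CharSpace.continuous_eval {B : Type*} [CommRing B] [Algebra ℝ B] (b : B) :
    Continuous fun α : CharSpace B => α.eval b :=
  (continuous_apply b).comp continuous_induced_dom

/-- A Radon probability measure restricted to a measurable subset of full measure and pushed
forward along a continuous map is Radon. -/
theorem isRadonMeasure_map_comap {X Y : Type*} [TopologicalSpace X] [MeasurableSpace X]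
    [BorelSpace X] [TopologicalSpace Y] [MeasurableSpace Y] [BorelSpace Y] (μ : Measure X)
    [IsFiniteMeasure μ] [μ.InnerRegular] {G : Set X} (hG : MeasurableSet G) {Φ : G → Y}
    (hΦ : Continuous Φ) : IsRadonMeasure ((μ.comap ((↑) : G → X)).map Φ) := by
  have hfin : IsFiniteMeasure (μ.comap ((↑) : G → X)) := inferInstance
  have hreg : (μ.comap ((↑) : G → X)).InnerRegular :=
    ⟨(Measure.InnerRegular.innerRegular (μ := μ)).comap (MeasurableEmbedding.subtype_coe hG)
      (fun _ hU => (MeasurableEmbedding.subtype_coe hG).measurableSet_image' hU)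
      (fun _ hK hc => IsInducing.subtypeVal.isCompact_preimage' hc hK)⟩
  exact ⟨inferInstance, Measure.InnerRegular.map_of_continuous hΦ⟩

variable {B : Type*} [CommRing B] [Algebra ℝ B]

/-- The set of characters which are bounded on `D` by a multiple of `w` is a Borel set. -/
theorem measurableSet_bounded_characters (D : Set B) (w : B → ℝ) :
    MeasurableSet {α : CharSpace B | ∃ n : ℕ, ∀ u ∈ D, |α.eval u| ≤ ((n : ℝ) + 1) * w u} := by
  rw [Set.ofPred_exists]
  refine MeasurableSet.iUnion fun n => IsClosed.measurableSet ?_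
  simp only [Set.ofPred_forall]
  exact isClosed_iInter fun u => isClosed_iInter fun _ =>
    isClosed_le (CharSpace.continuous_eval u).abs continuous_const

/-- A regular probability measure on the cube which is concentrated on the character-like points
and has the right truncated moments yields a representing Radon measure. -/
theorem exists_isRepresentingRadonMeasure_of_cube {D : Set B} (hD : Algebra.adjoin ℝ D = ⊤)
    (w : B → ℝ) (ℓ : B →ₗ[ℝ] ℝ) (μ : Measure (Cube B)) [IsProbabilityMeasure μ] [μ.InnerRegular]
    (hμ : μ (⋃ n : ℕ, Cube.characterLike Set.univ D fun u => ((n : ℝ) + 1) * w u)ᶜ = 0)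
    (hfst : ∀ b, ∀ δ > 0, |∫ t, truncFst δ (Cube.coord b t) ∂μ - ℓ b| ≤ δ * ℓ (b ^ 2))
    (hsnd : ∀ b, ∀ δ > 0, ∫ t, truncSnd δ (Cube.coord b t) ∂μ ≤ ℓ (b ^ 2)) :
    ∃ ν : Measure (CharSpace B), IsRepresentingRadonMeasure ℓ ν ∧
      ν {α | ∃ n : ℕ, ∀ u ∈ D, |α.eval u| ≤ ((n : ℝ) + 1) * w u}ᶜ = 0 := by
  set G : Set (Cube B) := ⋃ n : ℕ, Cube.characterLike Set.univ D fun u => ((n : ℝ) + 1) * w u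
    with hG_def
  have hG : MeasurableSet G :=
    MeasurableSet.iUnion fun n => (Cube.isClosed_characterLike _ _ _).measurableSet
  have hmem : ∀ t : G, ∃ n : ℕ,
      (t : Cube B) ∈ Cube.characterLike Set.univ D fun u => ((n : ℝ) + 1) * w u :=
    fun t => Set.mem_iUnion.1 t.2
  -- The choice of `n` need not be measurable: the values of the resulting character are `Cube.val b
  -- t`, whatever `n` is.
  choose n hn using hmem
  let Φ : G → CharSpace B := fun t => Cube.toCharSpace hD (hn t)
  have hpos : ∀ (t : G) (b : B), 0 < Cube.cocoord b (t : Cube B) :=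
    fun t b => Cube.cocoord_pos hD (hn t) b
  have hΦ : Continuous Φ := by
    refine continuous_induced_rng.2 (continuous_pi fun b => ?_)
    exact continuousOn_unsquash.comp_continuous
      ((Cube.continuous_coord b).comp continuous_subtype_val) fun t => hpos t b
  have hae : ∀ᵐ t ∂μ, t ∈ G := hμ
  have hmap : (μ.comap ((↑) : G → Cube B)).map (↑) = μ := by
    rw [map_comap_subtype_coe hG, Measure.restrict_eq_self_of_ae_mem hae]
  refine ⟨(μ.comap (↑)).map Φ, ⟨isRadonMeasure_map_comap μ hG hΦ, fun b => ?_⟩, ?_⟩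
  · obtain ⟨h1, h2⟩ := integrable_unsquash_of_trunc μ (Cube.continuous_coord b)
      (Cube.coord_mem b) (hae.mono fun t ht => hpos ⟨t, ht⟩ b) (hfst b) (hsnd b)
    have hev := (CharSpace.continuous_eval b).aestronglyMeasurable
      (μ := (μ.comap ((↑) : G → Cube B)).map Φ)
    rw [← hmap] at h1 h2
    have e := (MeasurableEmbedding.subtype_coe hG)
    rw [e.integrable_map_iff] at h1
    rw [e.integral_map] at h2
    exact ⟨(integrable_map_measure hev hΦ.aemeasurable).2 h1,
      h2.trans (integral_map hΦ.aemeasurable hev).symm⟩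
  · rw [Measure.map_apply hΦ.measurable (measurableSet_bounded_characters D w).compl]
    convert measure_empty (μ := μ.comap ((↑) : G → Cube B))
    refine Set.eq_empty_of_forall_notMem fun t ht => ht ⟨n t, fun u hu => ?_⟩
    exact Cube.abs_val_le hD (hn t) hu

/-- A linear functional with a tight directed family of representing measures for its restrictions
to subalgebras has a representing Radon measure. -/
theorem exists_isRepresentingRadonMeasure_of_tight {D : Set B} (hD : Algebra.adjoin ℝ D = ⊤)
    (w : B → ℝ) (ℓ : B →ₗ[ℝ] ℝ) {I : Type*} [Preorder I] [IsDirectedOrder I] [Nonempty I]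
    {S : I → Subalgebra ℝ B} {E : I → Set B} (hS : Monotone S) (hE : Monotone E)
    (hSB : ∀ b, ∃ i, b ∈ S i) (hED : ∀ u ∈ D, ∃ i, u ∈ E i)
    {Ω : I → Type*} [∀ i, TopologicalSpace (Ω i)] [∀ i, MeasurableSpace (Ω i)]
    [∀ i, OpensMeasurableSpace (Ω i)] (ν : ∀ i, Measure (Ω i)) [∀ i, IsProbabilityMeasure (ν i)]
    (x : ∀ i, Ω i → B → ℝ) (hcont : ∀ i b, Continuous fun ω => x i ω b)
    (halg : ∀ i ω r, x i ω (algebraMap ℝ B r) = r)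
    (hadd : ∀ i ω, ∀ b ∈ S i, ∀ c ∈ S i, x i ω (b + c) = x i ω b + x i ω c)
    (hmul : ∀ i ω, ∀ b ∈ S i, ∀ c ∈ S i, x i ω (b * c) = x i ω b * x i ω c)
    (hint : ∀ i, ∀ b ∈ S i, Integrable (fun ω => x i ω b) (ν i) ∧ ℓ b = ∫ ω, x i ω b ∂(ν i))
    (T : ℝ) (htight : ∀ i, ∀ C > 0,
      (ν i).real {ω | ∀ u ∈ E i, |x i ω u| ≤ C * w u}ᶜ ≤ T / C ^ 2) :
    ∃ ν : Measure (CharSpace B), IsRepresentingRadonMeasure ℓ ν ∧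
      ν {α | ∃ n : ℕ, ∀ u ∈ D, |α.eval u| ≤ ((n : ℝ) + 1) * w u}ᶜ = 0 := by
  let φ : ∀ i, Ω i → Cube B := fun i ω => Cube.ofFun (x i ω)
  have hφ : ∀ i, Continuous (φ i) := fun i => Cube.continuous_ofFun (hcont i)
  let P : I → Measure (Cube B) := fun i => (ν i).map (φ i)
  have hP : ∀ i, IsProbabilityMeasure (P i) :=
    fun i => Measure.isProbabilityMeasure_map (hφ i).aemeasurable
  let 𝒰 : Ultrafilter I := Ultrafilter.of atTop
  have h𝒰 : (𝒰 : Filter I) ≤ atTop := Ultrafilter.of_le atTop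
  obtain ⟨μ, hreg, hprob, hμ⟩ := exists_regular_tendsto_integral 𝒰 P
  have hsq : ∀ i, ∀ b ∈ S i, Integrable (fun ω => x i ω b ^ 2) (ν i) ∧
      ℓ (b ^ 2) = ∫ ω, x i ω b ^ 2 ∂(ν i) := fun i b hb => by
    have h := hint i (b ^ 2) (pow_mem hb 2)
    simpa only [pow_two, hmul i _ b hb b hb] using h
  have hintP : ∀ {g : ℝ → ℝ}, ContinuousOn g (Set.Icc (-1 : ℝ) 1) → ∀ b i,
      Integrable (fun ω => g (squash (x i ω b))) (ν i) ∧
      ∫ t, g (Cube.coord b t) ∂(P i) = ∫ ω, g (squash (x i ω b)) ∂(ν i) := fun {g} hg b i => by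
    have hc : Continuous fun t : Cube B => g (Cube.coord b t) :=
      hg.comp_continuous (Cube.continuous_coord b) (Cube.coord_mem b)
    obtain ⟨C, hC⟩ := isCompact_Icc.exists_bound_of_continuousOn hg
    exact ⟨Integrable.of_bound (hc.comp (hφ i)).measurable.aestronglyMeasurable C
      (Eventually.of_forall fun ω => hC _ (squash_mem_Icc _)),
      integral_map (hφ i).aemeasurable hc.measurable.aestronglyMeasurable⟩
  have hlim : ∀ {g : ℝ → ℝ}, ContinuousOn g (Set.Icc (-1 : ℝ) 1) → ∀ b,
      Tendsto (fun i => ∫ t, g (Cube.coord b t) ∂(P i)) 𝒰 (𝓝 (∫ t, g (Cube.coord b t) ∂μ)) :=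
    fun hg b => hμ _ (hg.comp_continuous (Cube.continuous_coord b) (Cube.coord_mem b))
  have hev : ∀ b, ∀ᶠ i in (𝒰 : Filter I), b ∈ S i := fun b => by
    obtain ⟨i, hi⟩ := hSB b
    exact h𝒰 ((eventually_ge_atTop i).mono fun j hj => hS hj hi)
  refine exists_isRepresentingRadonMeasure_of_cube hD w ℓ μ ?_ (fun b δ hδ => ?_)
    fun b δ hδ => ?_
  -- For fixed `n`, imposing the conditions only on `S i` and `E i` gives a decreasing family of
  -- closed sets, to which the tightness bound applies at every later index.
  · have hclosed : ∀ n : ℕ, 1 - T / ((n : ℝ) + 1) ^ 2 ≤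
        μ.real (⋃ n : ℕ, Cube.characterLike Set.univ D fun u => ((n : ℝ) + 1) * w u) := fun n => by
      have hn : (0 : ℝ) < n + 1 := by positivity
      refine (le_measureReal_iInter_of_tendsto_integral h𝒰 hμ
        (F := fun i => Cube.characterLike (S i : Set B) (E i) fun u => ((n : ℝ) + 1) * w u)
        (fun i j hij => Cube.characterLike_anti (hS hij) (hE hij) _)
        (fun i => Cube.isClosed_characterLike _ _ _) (fun i j hij => ?_)).trans
        (measureReal_mono (fun t ht => Set.mem_iUnion.2 ⟨n, ?_⟩) (by finiteness))
      · have hm : MeasurableSet (Cube.characterLike (S i : Set B) (E i)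
            fun u => ((n : ℝ) + 1) * w u) := (Cube.isClosed_characterLike _ _ _).measurableSet
        have h1 : (P j).real (Cube.characterLike (S i : Set B) (E i)
            fun u => ((n : ℝ) + 1) * w u)ᶜ ≤ T / ((n : ℝ) + 1) ^ 2 := by
          rw [map_measureReal_apply (hφ j).measurable hm.compl]
          refine (measureReal_mono (Set.compl_subset_compl.2 fun ω hω => ?_)
            (by finiteness)).trans (htight j _ hn)
          exact Cube.ofFun_mem_characterLike (halg j ω)
            (fun b hb c hc => hadd j ω b (hS hij hb) c (hS hij hc))
            (fun b hb c hc => hmul j ω b (hS hij hb) c (hS hij hc)) fun u hu => hω u (hE hij hu)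
        rw [probReal_compl_eq_one_sub hm] at h1
        linarith
      · rw [Set.mem_iInter] at ht
        obtain ⟨i₀⟩ := ‹Nonempty I›
        -- Each relation involves only two elements, so by directedness it is already imposed at
        -- some index.
        have hpair : ∀ b c : B, ∃ i, b ∈ S i ∧ c ∈ S i := fun b c => by
          obtain ⟨i, hi⟩ := hSB b
          obtain ⟨j, hj⟩ := hSB c
          obtain ⟨k, hik, hjk⟩ := exists_ge_ge i j
          exact ⟨k, hS hik hi, hS hjk hj⟩
        refine ⟨(ht i₀).1, fun b _ c _ => ?_, fun b _ c _ => ?_, fun u hu => ?_⟩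
        · obtain ⟨i, hb, hc⟩ := hpair b c
          exact (ht i).2.1 b hb c hc
        · obtain ⟨i, hb, hc⟩ := hpair b c
          exact (ht i).2.2.1 b hb c hc
        · obtain ⟨i, hi⟩ := hED u hu
          exact (ht i).2.2.2 u hi
    have hlim1 : Tendsto (fun n : ℕ => 1 - T / ((n : ℝ) + 1) ^ 2) atTop (𝓝 (1 - T * 0 ^ 2)) :=
      tendsto_const_nhds.sub ((tendsto_one_div_add_atTop_nhds_zero_nat.pow 2).const_mul T |>.congr
        fun n => by rw [div_pow, one_pow, mul_one_div])
    have h1 := le_of_tendsto' (by simpa using hlim1) hclosed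
    rw [prob_compl_eq_zero_iff (MeasurableSet.iUnion fun n =>
      (Cube.isClosed_characterLike _ _ _).measurableSet)]
    exact (ENNReal.toReal_eq_one_iff _).1 (le_antisymm measureReal_le_one h1)
  · refine le_of_tendsto ((hlim (continuousOn_truncFst hδ) b).sub_const (ℓ b)).abs
      ((hev b).mono fun i hi => ?_)
    obtain ⟨h1, h2⟩ := hintP (continuousOn_truncFst hδ) b i
    obtain ⟨h3, h4⟩ := hint i b hi
    obtain ⟨h5, h6⟩ := hsq i b hi
    rw [h2, h4, ← integral_sub h1 h3, h6, ← integral_const_mul]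
    refine abs_integral_le_integral_abs.trans (integral_mono (h1.sub h3).abs (h5.const_mul δ)
      fun ω => ?_)
    simpa only [unsquash_squash] using
      abs_truncFst_sub_le hδ (sqrt_one_sub_squash_sq_pos (x i ω b))
  · refine le_of_tendsto (hlim (continuousOn_truncSnd hδ) b) ((hev b).mono fun i hi => ?_)
    obtain ⟨h1, h2⟩ := hintP (continuousOn_truncSnd hδ) b i
    obtain ⟨h5, h6⟩ := hsq i b hi
    rw [h2, h6]
    refine integral_mono h1 h5 fun ω => ?_
    simpa only [unsquash_squash] using truncSnd_le δ (sqrt_one_sub_squash_sq_pos (x i ω b))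

end Existence

/-! ### Trace bound implies tightness. -/

section Tightness

open RealInnerProductSpace

/-- A random linear functional on a finite dimensional space whose second moments have trace at
most `T` with respect to a Hilbertian seminorm is bounded by `C` times that seminorm with
probability at least `1 - T / C²`. -/
theorem measureReal_not_bounded_le {W H Ω : Type*} [AddCommGroup W] [Module ℝ W]
    [FiniteDimensional ℝ W] [NormedAddCommGroup H] [InnerProductSpace ℝ H] [MeasurableSpace Ω]
    (ν : Measure Ω) [IsProbabilityMeasure ν] (J : W →ₗ[ℝ] H) (X : Ω → W →ₗ[ℝ] ℝ) {s : W → ℝ}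
    (hX : ∀ u, Integrable (fun ω => X ω u ^ 2) ν ∧ s u = ∫ ω, X ω u ^ 2 ∂ν)
    (hker : ∀ u, J u = 0 → s u = 0) {T : ℝ}
    (hT : ∀ (k : ℕ) (f : Fin k → W), Orthonormal ℝ (fun i => J (f i)) → ∑ i, s (f i) ≤ T)
    {C : ℝ} (hC : 0 < C) : ν.real {ω | ∀ u, |X ω u| ≤ C * ‖J u‖}ᶜ ≤ T / C ^ 2 := by
  let b := stdOrthonormalBasis ℝ (LinearMap.range J)
  choose f hf using fun i => (b i).2
  have horth : Orthonormal ℝ (fun i => J (f i)) := by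
    simp only [hf]
    exact b.orthonormal.comp_linearIsometry (LinearMap.range J).subtypeₗᵢ
  have hexp : ∀ u, u - ∑ i, ⟪(b i : H), J u⟫ • f i ∈ LinearMap.ker J := fun u => by
    have h := congrArg Subtype.val (b.sum_repr' ⟨J u, LinearMap.mem_range_self J u⟩)
    rw [LinearMap.mem_ker, map_sub, map_sum, sub_eq_zero]
    simp only [map_smul, hf]
    rw [Submodule.coe_sum] at h
    exact h.symm
  have hnorm : ∀ u, ∑ i, ⟪(b i : H), J u⟫ ^ 2 = ‖J u‖ ^ 2 := fun u => by
    have h := b.sum_sq_norm_inner_right ⟨J u, LinearMap.mem_range_self J u⟩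
    simp only [Real.norm_eq_abs, sq_abs] at h
    exact h
  -- Finitely many generators of `ker J` suffice, so a single null set works for the whole kernel;
  -- outside it `X ω` factors through the range of `J`.
  obtain ⟨G, hG⟩ : (LinearMap.ker J).FG := IsNoetherian.noetherian _
  have hae : ∀ᵐ ω ∂ν, ∀ g ∈ G, X ω g = 0 := by
    refine (Finset.eventually_all G).2 fun g hg => ?_
    have h0 : ∫ ω, X ω g ^ 2 ∂ν = 0 := by
      rw [← (hX g).2]
      exact hker g (LinearMap.mem_ker.1 (hG ▸ Submodule.subset_span hg))
    have := (integral_eq_zero_iff_of_nonneg (fun ω => sq_nonneg (X ω g)) (hX g).1).1 h0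
    exact this.mono fun ω hω => pow_eq_zero_iff two_ne_zero |>.1 hω
  have hsub : ∀ᵐ ω ∂ν, ω ∈ {ω | ∀ u, |X ω u| ≤ C * ‖J u‖}ᶜ →
      ω ∈ {ω | C ^ 2 ≤ ∑ i, X ω (f i) ^ 2} := by
    filter_upwards [hae] with ω hω hbad
    by_contra hlt
    refine hbad fun u => ?_
    have hlt : ∑ i, X ω (f i) ^ 2 < C ^ 2 := not_le.1 hlt
    have hle : LinearMap.ker J ≤ LinearMap.ker (X ω) := by
      rw [← hG, Submodule.span_le]
      exact fun g hg => hω g hg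
    have hXu : X ω u = ∑ i, ⟪(b i : H), J u⟫ * X ω (f i) := by
      have h := LinearMap.mem_ker.1 (hle (hexp u))
      simpa [map_sub, map_sum, sub_eq_zero] using h
    -- Cauchy–Schwarz: `∑ X ω (f i)²` bounds the squared dual norm of `X ω`, and Markov's inequality
    -- below controls its size.
    have hcs := Finset.sum_mul_sq_le_sq_mul_sq Finset.univ (fun i => ⟪(b i : H), J u⟫)
      fun i => X ω (f i)
    rw [← hXu, hnorm] at hcs
    refine abs_le_of_sq_le_sq ?_ (by positivity)
    calc X ω u ^ 2 ≤ ‖J u‖ ^ 2 * ∑ i, X ω (f i) ^ 2 := hcs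
      _ ≤ ‖J u‖ ^ 2 * C ^ 2 := by gcongr
      _ = (C * ‖J u‖) ^ 2 := by ring
  have hmarkov := mul_meas_ge_le_integral_of_nonneg (μ := ν)
    (f := fun ω => ∑ i, X ω (f i) ^ 2)
    (Filter.Eventually.of_forall fun ω => Finset.sum_nonneg fun i _ => sq_nonneg _)
    (integrable_finsetSum _ fun i _ => (hX (f i)).1) (C ^ 2)
  rw [integral_finsetSum _ fun i _ => (hX (f i)).1] at hmarkov
  simp only [← (hX _).2] at hmarkov
  rw [le_div_iff₀ (by positivity), mul_comm]
  refine le_trans ?_ (hmarkov.trans (hT _ f horth))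
  exact mul_le_mul_of_nonneg_left
    (ENNReal.toReal_mono (measure_ne_top _ _) (measure_mono_ae hsub)) (sq_nonneg C)

end Tightness

/-! ### The weighted seminorm and its trace. -/

section Weighted

open RealInnerProductSpace

variable {A : Type*} [CommRing A] [Algebra ℝ A] {L : A →ₗ[ℝ] ℝ} {V : Submodule ℝ A} {ι : Type*}
  {e : ι → V} {lam : ι → ℝ}

variable (L V e lam) in
/-- The map `v ↦ (λ_n⁻¹ L(v e_n))_n` of the weighted subspace into `ℓ²`. -/
noncomputable def weightedMap : weightedSubspace L V e lam →ₗ[ℝ] lp (fun _ : ι => ℝ) 2 where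
  toFun v := ⟨fun n => (lam n)⁻¹ * L (v * (e n : A)), memℓp_gen <| by
    refine v.2.2.congr fun n => ?_
    simp [mul_pow]⟩
  map_add' v w := by
    ext n
    simp only [Submodule.coe_add, add_mul, map_add, mul_add]
    rfl
  map_smul' c v := by
    ext n
    simp
    ring

theorem weightedMap_apply (v : weightedSubspace L V e lam) (n : ι) :
    weightedMap L V e lam v n = (lam n)⁻¹ * L (v * (e n : A)) := rfl

theorem weightedSeminorm_eq_norm (v : weightedSubspace L V e lam) :
    weightedSeminorm L V e lam (v : A) = ‖weightedMap L V e lam v‖ := by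
  rw [weightedSeminorm, ← Real.sqrt_sq (norm_nonneg (weightedMap L V e lam v)),
    ← real_inner_self_eq_norm_sq, lp.inner_eq_tsum]
  congr 1
  refine tsum_congr fun n => ?_
  rw [weightedMap_apply, real_inner_self_eq_norm_sq, Real.norm_eq_abs, sq_abs, mul_pow]

theorem sL_sq (hL : IsSumSqPositive L) (a : A) : sL L a ^ 2 = L (a ^ 2) :=
  Real.sq_sqrt (hL _ (by rw [pow_two]; exact IsSumSq.mul_self a))

theorem IsCompleteOrthonormalSystem.map_mul_eq (hL : IsSumSqPositive L)
    (he : IsCompleteOrthonormalSystem (fun v : V => sL L (v : A)) e) [DecidableEq ι] (i j : ι) :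
    L ((e i : A) * e j) = if i = j then 1 else 0 := by
  split_ifs with h
  · subst h
    have := sL_sq hL (e i : A)
    rw [show sL L (e i : A) = 1 from he.1 i, one_pow] at this
    rw [← pow_two, ← this]
  · rw [← hilbInner_sL hL]
    exact he.2.1 i j h

theorem IsCompleteOrthonormalSystem.mem_weightedSubspace (hL : IsSumSqPositive L)
    (he : IsCompleteOrthonormalSystem (fun v : V => sL L (v : A)) e) (i : ι) :
    (e i : A) ∈ weightedSubspace L V e lam := by
  classical
  refine ⟨(e i).2, summable_of_ne_finset_zero (s := {i}) fun n hn => ?_⟩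
  rw [he.map_mul_eq hL, if_neg (fun h => hn (by simp [h]))]
  simp

/-- Completeness in the form of an approximate Parseval inequality. -/
theorem IsCompleteOrthonormalSystem.exists_le_sum_add (hL : IsSumSqPositive L)
    (he : IsCompleteOrthonormalSystem (fun v : V => sL L (v : A)) e) {v : A} (hv : v ∈ V) {ε : ℝ}
    (hε : 0 < ε) : ∃ s : Finset ι, L (v ^ 2) ≤ ∑ n ∈ s, L (v * (e n : A)) ^ 2 + ε := by
  classical
  obtain ⟨u, hu, hvu⟩ := he.2.2 ⟨v, hv⟩ (√ε) (Real.sqrt_pos.2 hε)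
  obtain ⟨c, rfl⟩ := Finsupp.mem_span_range_iff_exists_finsupp.1 hu
  set r : A := ∑ n ∈ c.support, c n • (e n : A) with hr
  have hcoe : (((⟨v, hv⟩ : V) - c.sum fun n a => a • e n : V) : A) = v - r := by
    simp [Finsupp.sum, hr]
  have h1 : L ((v - r) ^ 2) ≤ ε := by
    rw [← sL_sq hL, ← hcoe]
    calc _ ≤ √ε ^ 2 := pow_le_pow_left₀ (Real.sqrt_nonneg _) hvu.le 2
      _ = ε := Real.sq_sqrt hε.le
  have h2 : L (v * r) = ∑ n ∈ c.support, c n * L (v * (e n : A)) := by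
    simp [hr, Finset.mul_sum]
  have h3 : L (r * r) = ∑ n ∈ c.support, c n * c n := by
    rw [hr, Finset.sum_mul_sum, map_sum]
    refine Finset.sum_congr rfl fun n hn => ?_
    rw [map_sum, Finset.sum_eq_single_of_mem n hn fun m _ hm => ?_]
    · simp [he.map_mul_eq hL]
    · simp [he.map_mul_eq hL, hm.symm]
  have h4 : L ((v - r) ^ 2) = L (v ^ 2) - 2 * L (v * r) + L (r * r) := by
    rw [show (v - r) ^ 2 = v ^ 2 - (v * r + v * r) + r * r by ring]
    simp only [map_add, map_sub]
    ring
  refine ⟨c.support, ?_⟩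
  -- Termwise this is `2ca - c² ≤ a²`: Fourier coefficients are the optimal choice.
  have h5 : 2 * L (v * r) - L (r * r) ≤ ∑ n ∈ c.support, L (v * (e n : A)) ^ 2 := by
    rw [h2, h3, Finset.mul_sum, ← Finset.sum_sub_distrib]
    exact Finset.sum_le_sum fun n _ => by nlinarith [sq_nonneg (c n - L (v * (e n : A)))]
  linarith

/-- All Fourier coefficients of `v` vanish, so completeness leaves only an arbitrarily small
remainder. -/
theorem IsCompleteOrthonormalSystem.map_sq_eq_zero (hL : IsSumSqPositive L)
    (he : IsCompleteOrthonormalSystem (fun v : V => sL L (v : A)) e) (hlam : ∀ n, 0 < lam n)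
    {v : weightedSubspace L V e lam} (hv : weightedMap L V e lam v = 0) :
    L ((v : A) ^ 2) = 0 := by
  refine le_antisymm (le_of_forall_pos_le_add fun ε hε => ?_)
    (hL _ (by rw [pow_two]; exact IsSumSq.mul_self _))
  obtain ⟨s, hs⟩ := he.exists_le_sum_add hL v.2.1 hε
  refine hs.trans (le_of_eq ?_)
  congr 1
  refine Finset.sum_eq_zero fun n _ => ?_
  have h := weightedMap_apply v n
  rw [hv, lp.coeFn_zero, Pi.zero_apply] at h
  have := (mul_eq_zero.1 h.symm).resolve_left (inv_pos.2 (hlam n)).ne'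
  rw [this]
  norm_num

/-- The trace of `s_L` with respect to the weighted seminorm is at most `∑ λ_n²`. -/
theorem IsCompleteOrthonormalSystem.sum_map_sq_le (hL : IsSumSqPositive L)
    (he : IsCompleteOrthonormalSystem (fun v : V => sL L (v : A)) e) (hlam : ∀ n, 0 < lam n)
    (hsum : Summable fun n => lam n ^ 2) {κ : Type*} [Fintype κ]
    (f : κ → weightedSubspace L V e lam)
    (hf : Orthonormal ℝ fun i => weightedMap L V e lam (f i)) :
    ∑ i, L ((f i : A) ^ 2) ≤ ∑' n, lam n ^ 2 := by
  classical
  refine le_of_forall_pos_le_add fun ε hε => ?_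
  -- Each index gets an equal share of `ε`; the `+ 1` covers empty `κ`.
  have hd : 0 < ε / (Fintype.card κ + 1) := by positivity
  choose s hs using fun i => he.exists_le_sum_add hL (f i).2.1 hd
  -- Bessel's inequality for the n-th unit vector of ℓ².
  have hbessel : ∀ n, ∑ i, L ((f i : A) * e n) ^ 2 ≤ lam n ^ 2 := fun n => by
    have h := hf.sum_inner_products_le (s := Finset.univ) (lp.single 2 n (1 : ℝ))
    rw [lp.norm_single (by norm_num)] at h
    simp only [lp.inner_single_right, weightedMap_apply] at h
    have hterm : ∀ i, ‖⟪(lam n)⁻¹ * L ((f i : A) * e n), (1 : ℝ)⟫‖ ^ 2 =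
        (lam n ^ 2)⁻¹ * L ((f i : A) * e n) ^ 2 := fun i => by
      rw [Real.norm_eq_abs, sq_abs]
      simp [mul_pow]
    simp only [hterm, ← Finset.mul_sum, norm_one, one_pow] at h
    rwa [inv_mul_le_iff₀ (pow_pos (hlam n) 2), mul_one] at h
  calc ∑ i, L ((f i : A) ^ 2)
      ≤ ∑ i, (∑ n ∈ Finset.univ.biUnion s, L ((f i : A) * e n) ^ 2 +
          ε / (Fintype.card κ + 1)) := by
        refine Finset.sum_le_sum fun i _ => (hs i).trans ?_
        gcongr
        exact Finset.subset_biUnion_of_mem s (Finset.mem_univ i)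
    _ = ∑ n ∈ Finset.univ.biUnion s, ∑ i, L ((f i : A) * e n) ^ 2 +
          Fintype.card κ * (ε / (Fintype.card κ + 1)) := by
        rw [Finset.sum_add_distrib, Finset.sum_comm]
        simp
    _ ≤ ∑' n, lam n ^ 2 + ε := by
        refine add_le_add ((Finset.sum_le_sum fun n _ => hbessel n).trans
          (hsum.sum_le_tsum _ fun n _ => sq_nonneg _)) ?_
        rw [mul_div_assoc', div_le_iff₀ (by positivity)]
        nlinarith

theorem isHilbertianSeminorm_norm_comp {E H : Type*} [AddCommGroup E] [Module ℝ E]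
    [NormedAddCommGroup H] [InnerProductSpace ℝ H] (J : E →ₗ[ℝ] H) :
    IsHilbertianSeminorm fun v => ‖J v‖ :=
  ⟨(innerₗ H).compl₁₂ J J, fun _ _ => real_inner_comm _ _, fun _ => real_inner_self_nonneg,
    fun _ => norm_eq_sqrt_real_inner _⟩

theorem hilbInner_norm_comp {E H : Type*} [AddCommGroup E] [Module ℝ E]
    [NormedAddCommGroup H] [InnerProductSpace ℝ H] (J : E →ₗ[ℝ] H) (v w : E) :
    hilbInner (fun v => ‖J v‖) v w = ⟪J v, J w⟫ := by
  rw [real_inner_eq_norm_add_mul_self_sub_norm_mul_self_sub_norm_mul_self_div_two, hilbInner,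
    map_add]
  ring

theorem hilbTrace_weighted_lt_top (hL : IsSumSqPositive L)
    (he : IsCompleteOrthonormalSystem (fun v : V => sL L (v : A)) e) (hlam : ∀ n, 0 < lam n)
    (hsum : Summable fun n => lam n ^ 2) :
    hilbTrace (fun u : weightedSubspace L V e lam => sL L (u : A))
      (fun u => ‖weightedMap L V e lam u‖) < ⊤ := by
  classical
  rw [hilbTrace, if_pos fun v hv => by
    rw [sL, he.map_sq_eq_zero hL hlam (norm_eq_zero.1 hv), Real.sqrt_zero]]
  refine lt_of_le_of_lt (iSup_le fun F => ?_) (ENNReal.ofReal_lt_top (r := ∑' n, lam n ^ 2))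
  rw [← ENNReal.ofReal_sum_of_nonneg fun f _ => sq_nonneg _]
  refine ENNReal.ofReal_le_ofReal ?_
  simp only [sL_sq hL]
  rw [← Finset.sum_coe_sort]
  refine he.sum_map_sq_le hL hlam hsum (fun f : F.1 => f.1) ⟨fun f => F.2.1 f.1 f.2, fun f g hfg => ?_⟩
  have h := F.2.2 f.1 f.2 g.1 g.2 (fun h => hfg (Subtype.ext h))
  rwa [hilbInner_norm_comp] at h

end Weighted

/-! ### Finitely generated subalgebras and their characters. -/

section Generated

variable {A : Type*} [CommRing A] [Algebra ℝ A] {U : Submodule ℝ A}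

/-- The finite dimensional subspace of `U` spanned by a finite subset of `U`. -/
def finsetSpan (G : Finset U) : Submodule ℝ A := Submodule.span ℝ ((↑) '' (G : Set U))

theorem finsetSpan_mono : Monotone (finsetSpan : Finset U → Submodule ℝ A) := fun _ _ h =>
  Submodule.span_mono (Set.image_mono (Finset.coe_subset.2 h))

theorem finsetSpan_le (G : Finset U) : finsetSpan G ≤ U :=
  Submodule.span_le.2 (by rintro _ ⟨u, -, rfl⟩; exact u.2)

instance finiteDimensional_finsetSpan (G : Finset U) : FiniteDimensional ℝ (finsetSpan G) :=
  FiniteDimensional.span_of_finite ℝ (G.finite_toSet.image _)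

theorem mem_finsetSpan_singleton (u : U) : (u : A) ∈ finsetSpan {u} :=
  Submodule.subset_span ⟨u, by simp, rfl⟩

/-- The subalgebra `⟨W⟩` for the span `W` of a finite subset of `U`. -/
def finsetAdjoin (G : Finset U) : Subalgebra ℝ A := Algebra.adjoin ℝ (finsetSpan G : Set A)

theorem subset_finsetAdjoin (G : Finset U) : (finsetSpan G : Set A) ⊆ finsetAdjoin G :=
  Algebra.subset_adjoin (R := ℝ) (s := (finsetSpan G : Set A))

theorem mem_finsetAdjoin_singleton (u : U) : (u : A) ∈ finsetAdjoin {u} :=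
  subset_finsetAdjoin {u} (mem_finsetSpan_singleton u)

theorem finsetAdjoin_mono : Monotone (finsetAdjoin : Finset U → Subalgebra ℝ A) := fun _ _ h =>
  Algebra.adjoin_mono (finsetSpan_mono h)

theorem finsetAdjoin_mem (G : Finset U) : finsetAdjoin G ∈ finDimGenerated U :=
  ⟨finsetSpan G, finsetSpan_le G, inferInstance, rfl⟩

theorem exists_mem_finsetAdjoin {b : A} (hb : b ∈ Algebra.adjoin ℝ (U : Set A)) :
    ∃ G : Finset U, b ∈ finsetAdjoin G := by
  classical
  induction hb using Algebra.adjoin_induction with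
  | mem u hu =>
    obtain ⟨u, rfl⟩ : ∃ v : U, (v : A) = u := ⟨⟨u, SetLike.mem_coe.1 hu⟩, rfl⟩
    exact ⟨{u}, mem_finsetAdjoin_singleton u⟩
  | algebraMap r => exact ⟨∅, Subalgebra.algebraMap_mem _ r⟩
  | add b c _ _ hb hc =>
    obtain ⟨G, hG⟩ := hb
    obtain ⟨G', hG'⟩ := hc
    exact ⟨G ∪ G', add_mem (finsetAdjoin_mono Finset.subset_union_left hG)
      (finsetAdjoin_mono Finset.subset_union_right hG')⟩
  | mul b c _ _ hb hc =>
    obtain ⟨G, hG⟩ := hb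
    obtain ⟨G', hG'⟩ := hc
    exact ⟨G ∪ G', mul_mem (finsetAdjoin_mono Finset.subset_union_left hG)
      (finsetAdjoin_mono Finset.subset_union_right hG')⟩

/-- The restriction of a character to a linear subspace of its domain. -/
def CharSpace.restrictLinear {S : Subalgebra ℝ A} (α : CharSpace S) {W : Submodule ℝ A}
    (hW : (W : Set A) ⊆ S) : W →ₗ[ℝ] ℝ :=
  (show S →ₐ[ℝ] ℝ from α).toLinearMap ∘ₗ
    LinearMap.codRestrict (Subalgebra.toSubmodule S) W.subtype fun w => hW w.2

theorem IsRepresentingRadonMeasure.isProbabilityMeasure {B : Type*} [CommRing B] [Algebra ℝ B]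
    {ℓ : B →ₗ[ℝ] ℝ} (h1 : ℓ 1 = 1) {ν : Measure (CharSpace B)}
    (hν : IsRepresentingRadonMeasure ℓ ν) : IsProbabilityMeasure ν := by
  have he : ∀ α : CharSpace B, α.eval 1 = 1 := fun α => map_one (show B →ₐ[ℝ] ℝ from α)
  obtain ⟨-, h⟩ := hν.2 1
  simp only [h1, he, integral_const, smul_eq_mul, mul_one] at h
  exact ⟨(ENNReal.toReal_eq_one_iff _).1 h.symm⟩

open Classical in
/-- The values of a character of a subalgebra `S`, extended by zero. -/
noncomputable def CharSpace.extend {S R : Subalgebra ℝ A} (α : CharSpace S) (b : R) : ℝ :=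
  -- The default is harmless: relations are demanded only on `S`, and in the limit every `b`
  -- eventually lies in `S`.
  if h : (b : A) ∈ S then α.eval ⟨b, h⟩ else 0

theorem CharSpace.extend_of_mem {S R : Subalgebra ℝ A} (α : CharSpace S) {b : R}
    (h : (b : A) ∈ S) : α.extend b = α.eval ⟨b, h⟩ := dif_pos h

theorem CharSpace.continuous_extend {S R : Subalgebra ℝ A} (b : R) :
    Continuous fun α : CharSpace S => α.extend b := by
  by_cases h : (b : A) ∈ S
  · simp only [CharSpace.extend_of_mem _ h]
    exact CharSpace.continuous_eval _
  · simp only [CharSpace.extend, dif_neg h]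
    exact continuous_const

/-- A functional is represented by a Radon measure concentrated on the characters which are
continuous with respect to a Hilbertian seminorm, if its restrictions to the finitely generated
subalgebras have representing measures and the second moments have finite trace. -/
theorem exists_isRepresentingRadonMeasure_of_trace {H : Type*} [NormedAddCommGroup H]
    [InnerProductSpace ℝ H] (L : A →ₗ[ℝ] ℝ) (hL1 : L 1 = 1) (J : U →ₗ[ℝ] H)
    (hker : ∀ u, J u = 0 → L ((u : A) ^ 2) = 0) {T : ℝ}
    (hT : ∀ (k : ℕ) (f : Fin k → U), Orthonormal ℝ (fun i => J (f i)) →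
      ∑ i, L ((f i : A) ^ 2) ≤ T)
    (hrep : ∀ S ∈ finDimGenerated U, ∃ νS : Measure (CharSpace S),
      IsRepresentingRadonMeasure (restrictTo L S) νS) :
    ∃ ν : Measure (CharSpace (Algebra.adjoin ℝ (U : Set A))),
      IsRepresentingRadonMeasure (restrictTo L (Algebra.adjoin ℝ (U : Set A))) ν ∧
      ν {α | IsContinuousFor (fun u => ‖J u‖) (CharSpace.restrictGen U α)}ᶜ = 0 := by
  classical
  choose ν hν using fun G : Finset U => hrep _ (finsetAdjoin_mem G)
  have hprob : ∀ G, IsProbabilityMeasure (ν G) := fun G =>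
    (hν G).isProbabilityMeasure (ℓ := restrictTo L (finsetAdjoin G)) hL1
  let R := Algebra.adjoin ℝ (U : Set A)
  let w : R → ℝ := fun b => if h : (b : A) ∈ U then ‖J ⟨b, h⟩‖ else 0
  have hw : ∀ (b : R) (h : (b : A) ∈ U), w b = ‖J ⟨b, h⟩‖ := fun b h => dif_pos h
  have hadd : ∀ (G : Finset U) (α : CharSpace (finsetAdjoin G)) (b c : R),
      (b : A) ∈ finsetAdjoin G → (c : A) ∈ finsetAdjoin G →
      α.extend (b + c) = α.extend b + α.extend c := fun G α b c hb hc => by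
    rw [α.extend_of_mem hb, α.extend_of_mem hc, α.extend_of_mem (b := b + c) (add_mem hb hc)]
    exact map_add (show finsetAdjoin G →ₐ[ℝ] ℝ from α) ⟨b, hb⟩ ⟨c, hc⟩
  have hmul : ∀ (G : Finset U) (α : CharSpace (finsetAdjoin G)) (b c : R),
      (b : A) ∈ finsetAdjoin G → (c : A) ∈ finsetAdjoin G →
      α.extend (b * c) = α.extend b * α.extend c := fun G α b c hb hc => by
    rw [α.extend_of_mem hb, α.extend_of_mem hc, α.extend_of_mem (b := b * c) (mul_mem hb hc)]
    exact map_mul (show finsetAdjoin G →ₐ[ℝ] ℝ from α) ⟨b, hb⟩ ⟨c, hc⟩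
  have halg : ∀ (G : Finset U) (α : CharSpace (finsetAdjoin G)) (r : ℝ),
      α.extend (algebraMap ℝ R r) = r := fun G α r => by
    rw [α.extend_of_mem (b := algebraMap ℝ R r) ((finsetAdjoin G).algebraMap_mem r)]
    exact AlgHom.commutes (show finsetAdjoin G →ₐ[ℝ] ℝ from α) r
  have hint : ∀ (G : Finset U) (b : R), (b : A) ∈ finsetAdjoin G →
      Integrable (fun α : CharSpace (finsetAdjoin G) => α.extend b) (ν G) ∧
      restrictTo L R b = ∫ α : CharSpace (finsetAdjoin G), α.extend b ∂(ν G) := fun G b hb => by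
    simp only [CharSpace.extend_of_mem _ hb]
    exact (hν G).2 ⟨b, hb⟩
  have htight : ∀ (G : Finset U) (C : ℝ), 0 < C →
      (ν G).real {α : CharSpace (finsetAdjoin G) | ∀ u ∈ {b : R | (b : A) ∈ finsetSpan G},
        |α.extend u| ≤ C * w u}ᶜ ≤ T / C ^ 2 := fun G C hC => by
    have hsub : (finsetSpan G : Set A) ⊆ finsetAdjoin G := subset_finsetAdjoin G
    have hle := finsetSpan_le G
    refine le_trans (measureReal_mono (Set.compl_subset_compl.2 fun α hα u hu => ?_)
      (measure_ne_top _ _)) (measureReal_not_bounded_le (ν G) (J ∘ₗ Submodule.inclusion hle)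
      (fun α => α.restrictLinear hsub) (s := fun u => L ((u : A) ^ 2)) (fun u => ?_)
      (fun u hu => hker _ hu) (fun k f hf => hT k (fun i => Submodule.inclusion hle (f i)) hf) hC)
    · rw [α.extend_of_mem (hsub hu), hw u (hle hu)]
      exact hα ⟨u, hu⟩
    · have h := (hν G).2 (⟨u, hsub u.2⟩ ^ 2)
      have e : ∀ α : CharSpace (finsetAdjoin G),
          α.eval (⟨u, hsub u.2⟩ ^ 2) = α.restrictLinear hsub u ^ 2 := fun α =>
        map_pow (show finsetAdjoin G →ₐ[ℝ] ℝ from α) _ 2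
      simp only [e] at h
      exact h
  have hex : ∀ u ∈ ((↑) : R → A) ⁻¹' (U : Set A),
      ∃ G : Finset U, u ∈ {b : R | (b : A) ∈ finsetSpan G} := fun u hu => by
    obtain ⟨v, hv⟩ : ∃ v : U, (v : A) = u := ⟨⟨u, SetLike.mem_coe.1 hu⟩, rfl⟩
    refine ⟨{v}, ?_⟩
    rw [Set.mem_ofPred_eq, ← hv]
    exact mem_finsetSpan_singleton v
  obtain ⟨μ, hμ, hμ0⟩ := exists_isRepresentingRadonMeasure_of_tight
    (D := ((↑) : R → A) ⁻¹' (U : Set A)) Algebra.adjoin_adjoin_coe_preimage w (restrictTo L R)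
    (S := fun G : Finset U => (finsetAdjoin G).comap R.val)
    (E := fun G => {b : R | (b : A) ∈ finsetSpan G})
    (fun G G' h b hb => finsetAdjoin_mono h hb) (fun G G' h b hb => finsetSpan_mono h hb)
    (fun b => exists_mem_finsetAdjoin b.2) hex
    ν (fun _ α b => α.extend b) (fun _ b => CharSpace.continuous_extend b) halg
    (fun G α b hb c hc => hadd G α b c hb hc) (fun G α b hb c hc => hmul G α b c hb hc)
    hint T htight
  refine ⟨μ, hμ, measure_mono_null (Set.compl_subset_compl.2 ?_) hμ0⟩
  rintro α ⟨n, hn⟩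
  refine ⟨(n : ℝ) + 1, by positivity, fun u => ?_⟩
  have h := hn ⟨u, Algebra.subset_adjoin u.2⟩ u.2
  rwa [hw _ u.2] at h

end Generated

/-! ### The main theorem. -/

theorem mainTheorem8 {A : Type*} [CommRing A] [Algebra ℝ A]
    (V : Submodule ℝ A) (hV : Algebra.adjoin ℝ (V : Set A) = ⊤)
    (L : A →ₗ[ℝ] ℝ) (hL1 : L 1 = 1) (hLpos : IsSumSqPositive L)
    {ι : Type*} [Countable ι] (e : ι → V)
    (he : IsCompleteOrthonormalSystem (fun v : V => sL L (v : A)) e)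
    (lam : ι → ℝ) (hlam : ∀ n, 0 < lam n) (hsum : Summable fun n => lam n ^ 2)
    (U : Submodule ℝ A) (hU : U = weightedSubspace L V e lam)
    (q : U → ℝ) (hq : q = fun u : U => weightedSeminorm L V e lam (u : A)) :
    (U ≤ V ∧ (∀ v ∈ V, ∀ ε > 0, ∃ u ∈ U, sL L (v - u) < ε) ∧
      IsHilbertianSeminorm q ∧ hilbTrace (fun u : U => sL L (u : A)) q < ⊤) ∧
    ((∃ α : CharSpace A, IsContinuousFor (fun u : U => sL L (u : A)) (fun u : U => α.eval (u : A))) →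
      (∀ S ∈ finDimGenerated U, ∃ νS : Measure (CharSpace S),
        IsRepresentingRadonMeasure (restrictTo L S) νS) →
      ∃ ν : Measure (CharSpace (Algebra.adjoin ℝ (U : Set A))),
        IsRepresentingRadonMeasure (restrictTo L (Algebra.adjoin ℝ (U : Set A))) ν ∧
        ν {α | IsContinuousFor q (CharSpace.restrictGen U α)}ᶜ = 0) := by
  subst hU
  have hq' : q = fun u => ‖weightedMap L V e lam u‖ := by
    rw [hq]
    exact funext weightedSeminorm_eq_norm
  rw [hq']
  refine ⟨⟨fun v hv => hv.1, fun v hv ε hε => ?_, isHilbertianSeminorm_norm_comp _,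
    hilbTrace_weighted_lt_top hLpos he hlam hsum⟩, fun _ hrep => ?_⟩
  -- Density: the approximants from the span of the `e n` already lie in the weighted subspace,
  -- since each `e i` has only one nonzero coefficient.
  · obtain ⟨u, hu, hvu⟩ := he.2.2 ⟨v, hv⟩ ε hε
    refine ⟨u, ?_, hvu⟩
    have hle : Submodule.span ℝ (Set.range e) ≤
        (weightedSubspace L V e lam).comap V.subtype := Submodule.span_le.2 <| by
      rintro _ ⟨i, rfl⟩
      exact he.mem_weightedSubspace hLpos i
    exact hle hu
  · exact exists_isRepresentingRadonMeasure_of_trace L hL1 (weightedMap L V e lam)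
      (fun u hu => he.map_sq_eq_zero hLpos hlam hu)
      (fun k f hf => he.sum_map_sq_le hLpos hlam hsum f hf) hrep
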